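/- Write $\mathbb C_R=\{s\in\mathbb C:\operatorname{Re}s>0\}$, and let $\mathbf L_{I_m}$ ($\overline{\mathbf L}_{I_m}$) be the set of all $A\in\mathbb C^{m\times m}$ such that $A+A^*$ is positive definite (positive semidefinite). Let $F(s)$ be an $m\times m$-valued rational function with complex coefficients. Call $F$ - *positive real* if $F$ is analytic in $\mathbb C_R$ and $F(s)\in\overline{\mathbf L}_{I_m}$ for all $s\in\mathbb C_R$; - *strictly positive real* ($F\in\mathcal{SP}$) if $F(s-\epsilon)$ is positive real for some $\epsilon>0$; - *hyper-positive real* ($F\in\mathcal{HP}$) if $F$ maps $\mathbb C_R$ analytically and uniformly into $\mathbf L_{I_m}$, that is, $F$ is analytic in $\mathbb C_R$ and there is a finite $\eta>1$ such that $F(s)+F(s)^*-\frac1\eta\left(F(s)^*F(s)+I_m\right)$ is positive semidefinite for all $s\in\mathbb C_R$. Then $F\in\mathcal{HP}$ if and only if $F\in\mathcal{SP}$ and, in addition, $\lim_{s\to\infty}F(s)$ exists and belongs to $\mathbf L_{I_m}$. -/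

import Mathlib

open Matrix Filter Topology
open scoped ComplexOrder

/-- The open right half plane `ℂ_R`. -/
def rightHalfPlane : Set ℂ := {s : ℂ | 0 < s.re}

/-- The open Lyapunov set `L_I`: complex matrices with positive definite Hermitian part. -/
def lyapunovSet (m : ℕ) : Set (Matrix (Fin m) (Fin m) ℂ) :=
  {A | (A + Aᴴ).PosDef}

/-- The closed Lyapunov set: complex matrices with positive semidefinite Hermitian part. -/
def closedLyapunovSet (m : ℕ) : Set (Matrix (Fin m) (Fin m) ℂ) :=
  {A | (A + Aᴴ).PosSemidef}

/-- The matrix-valued function `s ↦ F(s)` given by a matrix of rational functions. `RatFunc.eval`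
uses the reduced fraction, so the value of an entry is the true one away from its poles; at a pole
it is a placeholder, and the entry is not continuous there. -/
noncomputable def evalAt {m : ℕ} (F : Matrix (Fin m) (Fin m) (RatFunc ℂ)) (s : ℂ) :
    Matrix (Fin m) (Fin m) ℂ :=
  F.map (RatFunc.eval (RingHom.id ℂ) s)

/-- All entries of `G` are analytic in the open right half plane. -/
def AnalyticOnRight {m : ℕ} (G : ℂ → Matrix (Fin m) (Fin m) ℂ) : Prop :=
  ∀ i j, AnalyticOnNhd ℂ (fun s => G s i j) rightHalfPlane

/-- Positive real: `G` analytically maps `ℂ_R` to the closed Lyapunov set. -/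
def IsPositiveReal {m : ℕ} (G : ℂ → Matrix (Fin m) (Fin m) ℂ) : Prop :=
  AnalyticOnRight G ∧ ∀ s ∈ rightHalfPlane, G s ∈ closedLyapunovSet m

/-- Strictly positive real: `s ↦ G (s - ε)` is positive real for some `ε > 0`. -/
def IsStrictlyPositiveReal {m : ℕ} (G : ℂ → Matrix (Fin m) (Fin m) ℂ) : Prop :=
  ∃ ε : ℝ, 0 < ε ∧ IsPositiveReal (fun s => G (s - (ε : ℂ)))

/-- Quantitatively hyper-positive real with a finite parameter `η`: `G` is analytic in `ℂ_R` and
`G(s) + G(s)* - (1/η) (G(s)* G(s) + I)` is positive semidefinite for all `s` in `ℂ_R`. -/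
def IsHyperPositiveRealWith {m : ℕ} (η : ℝ) (G : ℂ → Matrix (Fin m) (Fin m) ℂ) : Prop :=
  AnalyticOnRight G ∧ ∀ s ∈ rightHalfPlane,
    (G s + (G s)ᴴ - ((1 / η : ℝ) : ℂ) • ((G s)ᴴ * G s + 1)).PosSemidef

/-- Hyper-positive real: `G` maps `ℂ_R` analytically and uniformly into the Lyapunov set `L_I`,
that is, quantitatively hyper-positive real for some finite `η > 1` (both input and output
strictly passive). -/
def IsHyperPositiveReal {m : ℕ} (G : ℂ → Matrix (Fin m) (Fin m) ℂ) : Prop :=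
  ∃ η : ℝ, 1 < η ∧ IsHyperPositiveRealWith η G

/-! ### Hermitian forms -/

/-! Both directions are compactness of the closed right half plane with ∞ added, since positive
definiteness is open and semidefiniteness closed. Hyper-positivity bounds every entry
(`norm_apply_le_of_hyperForm`). A bounded rational function has no pole on the imaginary axis or at
∞, so the form inequality extends there and gives definiteness. The bad set is then compact in the
open left half plane, which leaves room for a shift (`exists_margin`). Conversely, the maximum
principle upgrades semidefiniteness on the shifted half plane to definiteness
(`mem_lyapunovSet_of_tendsto`). The form with `c = 0` is `A + Aᴴ`, so by compactness one small `c >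
0` serves all `s`. -/

theorem Matrix.IsHermitian.posDef_iff_re {m : ℕ} {A : Matrix (Fin m) (Fin m) ℂ}
    (hA : A.IsHermitian) :
    A.PosDef ↔ ∀ v, v ≠ 0 → 0 < (star v ⬝ᵥ (A *ᵥ v)).re := by
  rw [posDef_iff_dotProduct_mulVec]
  refine ⟨fun h v hv => (Complex.pos_iff.1 (h.2 hv)).1, fun h => ⟨hA, fun v hv => ?_⟩⟩
  exact Complex.pos_iff.2 ⟨h v hv, (hA.im_star_dotProduct_mulVec_self v).symm⟩

theorem Matrix.IsHermitian.posSemidef_iff_re {m : ℕ} {A : Matrix (Fin m) (Fin m) ℂ}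
    (hA : A.IsHermitian) :
    A.PosSemidef ↔ ∀ v, 0 ≤ (star v ⬝ᵥ (A *ᵥ v)).re := by
  rw [posSemidef_iff_dotProduct_mulVec]
  refine ⟨fun h v => (Complex.nonneg_iff.1 (h.2 v)).1, fun h => ⟨hA, fun v => ?_⟩⟩
  exact Complex.nonneg_iff.2 ⟨h v, (hA.im_star_dotProduct_mulVec_self v).symm⟩

theorem re_dotProduct_add_conjTranspose {m : ℕ} (A : Matrix (Fin m) (Fin m) ℂ) (v : Fin m → ℂ) :
    (star v ⬝ᵥ ((A + Aᴴ) *ᵥ v)).re = 2 * (star v ⬝ᵥ (A *ᵥ v)).re := by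
  have h : star v ⬝ᵥ (Aᴴ *ᵥ v) = star (star v ⬝ᵥ (A *ᵥ v)) := by
    rw [star_dotProduct, star_mulVec, conjTranspose_conjTranspose, dotProduct_mulVec]
  rw [add_mulVec, dotProduct_add, h]
  simp
  ring

theorem isHermitian_add_conjTranspose {m : ℕ} (A : Matrix (Fin m) (Fin m) ℂ) :
    (A + Aᴴ).IsHermitian :=
  isHermitian_add_transpose_self A

/-- Positive definiteness is an open condition on Hermitian matrices. -/
theorem eventually_posDef {α : Type*} {l : Filter α} {m : ℕ}
    {P : α → Matrix (Fin m) (Fin m) ℂ} {A : Matrix (Fin m) (Fin m) ℂ}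
    (hP : Tendsto P l (𝓝 A)) (hA : A.PosDef) (hH : ∀ x, (P x).IsHermitian) :
    ∀ᶠ x in l, (P x).PosDef := by
  have hcont : Continuous fun z : Matrix (Fin m) (Fin m) ℂ × (Fin m → ℂ) =>
      (star z.2 ⬝ᵥ (z.1 *ᵥ z.2)).re := by fun_prop
  -- Compactness of the unit sphere makes the neighbourhood of `A` independent of `v`; homogeneity
  -- then reaches all `v ≠ 0`.
  have key : ∀ᶠ B in 𝓝 A, ∀ v ∈ Metric.sphere (0 : Fin m → ℂ) 1,
      0 < (star v ⬝ᵥ (B *ᵥ v)).re := by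
    refine (isCompact_sphere (0 : Fin m → ℂ) 1).eventually_forall_of_forall_eventually
      fun v hv => ?_
    refine hcont.continuousAt.eventually (lt_mem_nhds ?_)
    exact (hA.isHermitian.posDef_iff_re.1 hA) v (ne_zero_of_mem_unit_sphere ⟨v, hv⟩)
  filter_upwards [hP.eventually key] with x hx
  refine (hH x).posDef_iff_re.2 fun v hv => ?_
  have hn : 0 < ‖v‖ := norm_pos_iff.2 hv
  have h := hx (((‖v‖⁻¹ : ℝ) : ℂ) • v) (by simp [norm_smul, hn.ne'])
  rw [mulVec_smul, star_smul, smul_dotProduct, dotProduct_smul, smul_smul, smul_eq_mul,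
    Complex.star_def, Complex.conj_ofReal, ← Complex.ofReal_mul, Complex.re_ofReal_mul] at h
  exact pos_of_mul_pos_right h (by positivity)

theorem isClosed_posSemidef (m : ℕ) :
    IsClosed {A : Matrix (Fin m) (Fin m) ℂ | A.PosSemidef} := by
  simp_rw [posSemidef_iff_dotProduct_mulVec, Set.ofPred_and, Set.ofPred_forall]
  refine (isClosed_eq (by fun_prop) continuous_id).inter (isClosed_iInter fun v => ?_)
  exact isClosed_le continuous_const (by fun_prop)

/-- The matrix whose positivity expresses quantitative hyper-positivity, with `c = 1 / η`. -/
noncomputable def hyperForm {m : ℕ} (c : ℝ) (A : Matrix (Fin m) (Fin m) ℂ) :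
    Matrix (Fin m) (Fin m) ℂ :=
  A + Aᴴ - (c : ℂ) • (Aᴴ * A + 1)

theorem isHermitian_hyperForm {m : ℕ} (c : ℝ) (A : Matrix (Fin m) (Fin m) ℂ) :
    (hyperForm c A).IsHermitian := by
  refine (isHermitian_add_conjTranspose A).sub ?_
  have h := (isHermitian_conjTranspose_mul_self A).add (isHermitian_one (n := Fin m) (α := ℂ))
  rw [IsHermitian, conjTranspose_smul, h.eq, Complex.star_def, Complex.conj_ofReal]

theorem continuous_hyperForm (m : ℕ) :
    Continuous fun z : ℝ × Matrix (Fin m) (Fin m) ℂ => hyperForm z.1 z.2 := by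
  unfold hyperForm
  fun_prop

theorem mem_lyapunovSet_of_hyperForm {m : ℕ} {c : ℝ} (hc : 0 < c)
    {A : Matrix (Fin m) (Fin m) ℂ} (h : (hyperForm c A).PosSemidef) : A ∈ lyapunovSet m := by
  have h1 : (Aᴴ * A + 1).PosDef :=
    PosDef.posSemidef_add (posSemidef_conjTranspose_mul_self A) PosDef.one
  have h2 : ((c : ℂ) • (Aᴴ * A + 1)).PosDef := h1.smul (by exact_mod_cast hc)
  have := PosDef.posSemidef_add h h2
  rwa [hyperForm, sub_add_cancel] at this

/-- Diagonal entry `j` of the form gives `c * ∑ k, ‖A k j‖ ^ 2 ≤ 2 * ‖A j j‖`. The term `k = j`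
bounds `A j j` by `2 / c`, and then the whole column. -/
theorem norm_apply_le_of_hyperForm {m : ℕ} {c : ℝ} (hc : 0 < c)
    {A : Matrix (Fin m) (Fin m) ℂ} (h : (hyperForm c A).PosSemidef) (i j : Fin m) :
    ‖A i j‖ ≤ 2 / c := by
  have hd := (Complex.nonneg_iff.1 (h.diag_nonneg (i := j))).1
  have hexp : (hyperForm c A j j).re = 2 * (A j j).re - c * (∑ k, ‖A k j‖ ^ 2 + 1) := by
    simp [hyperForm, mul_apply, Complex.normSq_apply, ← Complex.normSq_eq_norm_sq]
    ring
  have hle : ∀ k, c * ‖A k j‖ ^ 2 ≤ 2 * ‖A j j‖ := fun k => by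
    have h1 : ‖A k j‖ ^ 2 ≤ ∑ k, ‖A k j‖ ^ 2 :=
      Finset.single_le_sum (f := fun k => ‖A k j‖ ^ 2) (fun _ _ => by positivity)
        (Finset.mem_univ k)
    have h2 := Complex.re_le_norm (A j j)
    have h3 := mul_le_mul_of_nonneg_left h1 hc.le
    linarith
  have hjj : c * ‖A j j‖ ≤ 2 := by
    by_contra! hcon
    have := hle j
    have h0 : 0 < ‖A j j‖ := by
      by_contra! h0
      nlinarith [norm_nonneg (A j j)]
    nlinarith
  have hij := hle i
  rw [le_div_iff₀ hc]
  by_contra! hcon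
  nlinarith [norm_nonneg (A i j)]

/-! ### Rational functions bounded on the right half plane -/

theorem RatFunc.eval_num_ne_zero_of_eval_denom_eq_zero (f : RatFunc ℂ) (s : ℂ)
    (hs : f.denom.eval s = 0) : f.num.eval s ≠ 0 := by
  intro hn
  obtain ⟨a, b, hab⟩ := f.isCoprime_num_denom
  have := congrArg (Polynomial.eval s) hab
  simp [hs, hn] at this

/-- Near a point of the closed right half plane there are points of the open one. -/
theorem tendsto_add_ofReal (s : ℂ) :
    Tendsto (fun t : ℝ => s + t) (𝓝[>] 0) (𝓝 s) := by
  have : Continuous fun t : ℝ => s + (t : ℂ) := by fun_prop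
  simpa using (this.tendsto 0).mono_left nhdsWithin_le_nhds

theorem add_ofReal_mem_rightHalfPlane {s : ℂ} (hs : 0 ≤ s.re) {t : ℝ} (ht : 0 < t) :
    s + t ∈ rightHalfPlane := by
  simp only [rightHalfPlane, Set.mem_ofPred_eq, Complex.add_re, Complex.ofReal_re]
  linarith

/-- A polynomial dominated on the right half plane, away from the zeros of the dominating one,
is dominated on its closure. -/
theorem norm_eval_le_of_norm_div_le {p q : Polynomial ℂ} (hq : q ≠ 0) {M : ℝ}
    (h : ∀ s ∈ rightHalfPlane, ‖p.eval s / q.eval s‖ ≤ M) {s : ℂ} (hs : 0 ≤ s.re) :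
    ‖p.eval s‖ ≤ M * ‖q.eval s‖ := by
  -- At a root of `q` the quotient is `0` by convention and `h` says nothing, so `s` is approached
  -- through non-roots.
  have hroot : ∀ᶠ t : ℝ in 𝓝[>] 0, q.eval (s + t) ≠ 0 := by
    have hfin : {t : ℝ | q.eval (s + (t : ℂ)) = 0}.Finite := by
      refine (q.rootSet_finite ℂ).preimage (f := fun t : ℝ => s + (t : ℂ))
        (fun a _ b _ hab => by simpa using hab) |>.subset fun t ht => ?_
      simpa [Polynomial.mem_rootSet, hq] using ht
    have h0 : ({t : ℝ | q.eval (s + (t : ℂ)) = 0} \ {0})ᶜ ∈ 𝓝 (0 : ℝ) :=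
      (hfin.subset Set.sdiff_subset).isClosed.isOpen_compl.mem_nhds (by simp)
    filter_upwards [nhdsWithin_le_nhds h0, self_mem_nhdsWithin] with t ht ht0 hqt
    exact ht ⟨hqt, ne_of_gt ht0⟩
  have hp := (p.continuous.norm.tendsto s).comp (tendsto_add_ofReal s)
  have hq' := ((q.continuous.norm.tendsto s).const_mul M).comp (tendsto_add_ofReal s)
  refine le_of_tendsto_of_tendsto hp hq' ?_
  filter_upwards [hroot, self_mem_nhdsWithin] with t ht ht0
  have := h _ (add_ofReal_mem_rightHalfPlane hs ht0)
  rwa [norm_div, div_le_iff₀ (norm_pos_iff.2 ht)] at this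

theorem RatFunc.denom_eval_ne_zero_of_bounded {f : RatFunc ℂ} {M : ℝ}
    (h : ∀ s ∈ rightHalfPlane, ‖f.eval (RingHom.id ℂ) s‖ ≤ M) {s : ℂ} (hs : 0 ≤ s.re) :
    f.denom.eval s ≠ 0 := by
  intro h0
  have := norm_eval_le_of_norm_div_le f.denom_ne_zero h hs
  rw [h0, norm_zero, mul_zero, norm_le_zero_iff] at this
  exact RatFunc.eval_num_ne_zero_of_eval_denom_eq_zero f s h0 this

theorem eval_reflect_inv {p : Polynomial ℂ} {N : ℕ} (hp : p.natDegree ≤ N) {s : ℂ} (hs : s ≠ 0) :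
    p.eval s = (p.reflect N).eval s⁻¹ * s ^ N := by
  let := invertibleOfNonzero hs
  have := Polynomial.eval₂_reflect_mul_pow (RingHom.id ℂ) s N p hp
  rw [invOf_eq_inv] at this
  exact this.symm

theorem inv_mem_rightHalfPlane {s : ℂ} (hs : s ∈ rightHalfPlane) : s⁻¹ ∈ rightHalfPlane := by
  have h0 : s ≠ 0 := by rintro rfl; simp [rightHalfPlane] at hs
  simp only [rightHalfPlane, Set.mem_ofPred_eq, Complex.inv_re] at hs ⊢
  exact div_pos hs (Complex.normSq_pos.2 h0)

/-- Inversion preserves the right half plane and moves ∞ to the boundary point `0`, where the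
domination argument applies to the reflected polynomials. -/
theorem RatFunc.exists_tendsto_cobounded_of_bounded {f : RatFunc ℂ} {M : ℝ}
    (h : ∀ s ∈ rightHalfPlane, ‖f.eval (RingHom.id ℂ) s‖ ≤ M) :
    ∃ d, Tendsto (f.eval (RingHom.id ℂ)) (Bornology.cobounded ℂ) (𝓝 d) := by
  set N := max f.num.natDegree f.denom.natDegree with hN
  set p := f.num.reflect N with hp
  set q := f.denom.reflect N with hq
  have hf : ∀ s : ℂ, s ≠ 0 → f.eval (RingHom.id ℂ) s = p.eval s⁻¹ / q.eval s⁻¹ := by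
    intro s hs
    change f.num.eval s / f.denom.eval s = _
    rw [eval_reflect_inv (le_max_left _ f.denom.natDegree) hs,
      eval_reflect_inv (le_max_right f.num.natDegree _) hs,
      mul_div_mul_right _ _ (pow_ne_zero _ hs)]
  have hq0 : q ≠ 0 := by simpa [hq] using f.denom_ne_zero
  have hle : ‖p.eval 0‖ ≤ M * ‖q.eval 0‖ := by
    refine norm_eval_le_of_norm_div_le hq0 (fun w hw => ?_) (by simp)
    have hw' := inv_mem_rightHalfPlane hw
    have hne : w⁻¹ ≠ 0 := by intro h0; rw [h0] at hw'; simp [rightHalfPlane] at hw'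
    have := h _ hw'
    rwa [hf _ hne, inv_inv] at this
  have hp_eval : p.eval 0 = f.num.coeff N := by
    rw [← Polynomial.coeff_zero_eq_eval_zero, hp, Polynomial.coeff_reflect]; simp
  have hq_eval : q.eval 0 = f.denom.coeff N := by
    rw [← Polynomial.coeff_zero_eq_eval_zero, hq, Polynomial.coeff_reflect]; simp
  -- If `q` vanished at `0`, so would `p`; but one of these values is a leading coefficient. A zero
  -- numerator leaves a nonzero constant denominator.
  have hqz : q.eval 0 ≠ 0 := by
    intro h0
    rw [h0, norm_zero, mul_zero, norm_le_zero_iff] at hle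
    rw [hp_eval] at hle
    rw [hq_eval] at h0
    rcases le_total f.num.natDegree f.denom.natDegree with hd | hd
    · rw [hN, max_eq_right hd] at h0
      exact f.denom_ne_zero (Polynomial.leadingCoeff_eq_zero.1 h0)
    · rw [hN, max_eq_left hd] at hle
      have hnum : f.num = 0 := Polynomial.leadingCoeff_eq_zero.1 hle
      have hdeg : f.denom.natDegree = 0 := by simpa [hnum] using hd
      rw [hN, hnum, hdeg] at h0
      simp only [Polynomial.natDegree_zero, max_self] at h0
      rw [← hdeg] at h0
      exact f.denom_ne_zero (Polynomial.leadingCoeff_eq_zero.1 h0)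
  refine ⟨p.eval 0 / q.eval 0, ?_⟩
  have ht := ((p.continuous.tendsto 0).div (q.continuous.tendsto 0) hqz).comp
    (tendsto_inv₀_cobounded (α := ℂ))
  refine ht.congr' ?_
  filter_upwards [Bornology.eventually_ne_cobounded (0 : ℂ)] with s hs
  exact (hf s hs).symm

theorem RatFunc.analyticAt_eval {f : RatFunc ℂ} {s : ℂ} (hs : f.denom.eval s ≠ 0) :
    AnalyticAt ℂ (f.eval (RingHom.id ℂ)) s :=
  (AnalyticAt.aeval_polynomial analyticAt_id f.num).div
    (AnalyticAt.aeval_polynomial analyticAt_id f.denom) hs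

theorem Polynomial.eventually_cobounded_eval_ne_zero {q : Polynomial ℂ} (hq : q ≠ 0) :
    ∀ᶠ s in Bornology.cobounded ℂ, q.eval s ≠ 0 := by
  have : (q.rootSet ℂ)ᶜ ∈ Bornology.cobounded ℂ := by
    rw [← Bornology.isBounded_def]; exact (q.rootSet_finite ℂ).isBounded
  filter_upwards [this] with s hs h0
  exact hs (by simpa [Polynomial.mem_rootSet, hq] using h0)

theorem continuousAt_matrix {m : ℕ} {G : ℂ → Matrix (Fin m) (Fin m) ℂ} {s : ℂ}
    (h : ∀ i j, AnalyticAt ℂ (fun s => G s i j) s) : ContinuousAt G s :=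
  continuousAt_pi.2 fun i => continuousAt_pi.2 fun j => (h i j).continuousAt

theorem tendsto_ofReal_cobounded :
    Tendsto (fun t : ℝ => (t : ℂ)) atTop (Bornology.cobounded ℂ) := by
  rw [← tendsto_norm_atTop_iff_cobounded]
  simpa using tendsto_abs_atTop_atTop

/-! ### Hyper-positive real functions -/

/-- The complement of `V` is compact, so its real part attains a maximum, necessarily negative. -/
theorem exists_margin {V : Set ℂ} (hopen : IsOpen V) (hV : V ∈ Bornology.cobounded ℂ)
    (hright : ∀ s : ℂ, 0 ≤ s.re → s ∈ V) :
    ∃ ε : ℝ, 0 < ε ∧ ∀ s : ℂ, -ε < s.re → s ∈ V := by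
  have hcomp : IsCompact Vᶜ := by
    refine Metric.isCompact_of_isClosed_isBounded hopen.isClosed_compl ?_
    rwa [Bornology.isBounded_def, compl_compl]
  rcases Set.eq_empty_or_nonempty Vᶜ with h | h
  · exact ⟨1, one_pos, fun s _ => by simpa using (Set.compl_empty_iff.1 h ▸ Set.mem_univ s)⟩
  · obtain ⟨z, hz, hmax⟩ := hcomp.exists_isMaxOn h Complex.continuous_re.continuousOn
    refine ⟨-z.re, ?_, fun s hs => ?_⟩
    · by_contra! hcon
      exact hz (hright z (by linarith))
    · by_contra hsV
      have : s.re ≤ z.re := hmax hsV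
      linarith

theorem IsHyperPositiveReal.strictlyPositiveReal_and_tendsto {m : ℕ}
    {F : Matrix (Fin m) (Fin m) (RatFunc ℂ)} (hF : IsHyperPositiveReal (evalAt F)) :
    IsStrictlyPositiveReal (evalAt F) ∧
      ∃ D ∈ lyapunovSet m, Tendsto (evalAt F) (Bornology.cobounded ℂ) (𝓝 D) := by
  obtain ⟨η, hη, -, hform⟩ := hF
  have hc : 0 < 1 / η := by positivity
  change ∀ s ∈ rightHalfPlane, (hyperForm (1 / η) (evalAt F s)).PosSemidef at hform
  have hbd : ∀ i j, ∀ s ∈ rightHalfPlane, ‖(F i j).eval (RingHom.id ℂ) s‖ ≤ 2 / (1 / η) :=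
    fun i j s hs => norm_apply_le_of_hyperForm hc (hform s hs) i j
  have hden : ∀ i j (s : ℂ), 0 ≤ s.re → (F i j).denom.eval s ≠ 0 :=
    fun i j s hs => RatFunc.denom_eval_ne_zero_of_bounded (hbd i j) hs
  choose D hD using fun i j => RatFunc.exists_tendsto_cobounded_of_bounded (hbd i j)
  have hlim : Tendsto (evalAt F) (Bornology.cobounded ℂ) (𝓝 (Matrix.of D)) :=
    tendsto_pi_nhds.2 fun i => tendsto_pi_nhds.2 fun j => hD i j
  have hformcont : Continuous (hyperForm (m := m) (1 / η)) :=
    (continuous_hyperForm m).comp (Continuous.prodMk_right (1 / η))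
  have hcont : ∀ s : ℂ, (∀ i j, (F i j).denom.eval s ≠ 0) → ContinuousAt (evalAt F) s :=
    fun s hs => continuousAt_matrix fun i j => RatFunc.analyticAt_eval (hs i j)
  have hDL : Matrix.of D ∈ lyapunovSet m := by
    refine mem_lyapunovSet_of_hyperForm hc ?_
    refine (isClosed_posSemidef m).mem_of_tendsto
      ((hformcont.tendsto _).comp (hlim.comp tendsto_ofReal_cobounded)) ?_
    filter_upwards [eventually_gt_atTop 0] with t ht
    exact hform _ (by simpa [rightHalfPlane] using ht)
  have hclosed : ∀ s : ℂ, 0 ≤ s.re → evalAt F s ∈ lyapunovSet m := by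
    intro s hs
    refine mem_lyapunovSet_of_hyperForm hc ?_
    refine (isClosed_posSemidef m).mem_of_tendsto ((hformcont.tendsto _).comp
      ((hcont s fun i j => hden i j s hs).tendsto.comp (tendsto_add_ofReal s))) ?_
    filter_upwards [self_mem_nhdsWithin] with t ht
    exact hform _ (add_ofReal_mem_rightHalfPlane hs ht)
  have hadd : Continuous fun A : Matrix (Fin m) (Fin m) ℂ => A + Aᴴ := by fun_prop
  obtain ⟨ε, hε, hV⟩ := exists_margin
      (V := {s | (∀ i j, (F i j).denom.eval s ≠ 0) ∧ evalAt F s ∈ lyapunovSet m})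
      (by
        refine isOpen_iff_mem_nhds.2 fun s hs => ?_
        refine Filter.Eventually.and (eventually_all.2 fun i => eventually_all.2 fun j =>
          (F i j).denom.continuous.continuousAt.eventually_ne (hs.1 i j)) ?_
        exact eventually_posDef ((hadd.tendsto _).comp (hcont s hs.1).tendsto) hs.2
          fun _ => isHermitian_add_conjTranspose _)
      (by
        refine Filter.Eventually.and (eventually_all.2 fun i => eventually_all.2 fun j =>
          Polynomial.eventually_cobounded_eval_ne_zero (F i j).denom_ne_zero) ?_
        exact eventually_posDef ((hadd.tendsto _).comp hlim) hDL
          fun _ => isHermitian_add_conjTranspose _)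
      (fun s hs => ⟨fun i j => hden i j s hs, hclosed s hs⟩)
  have hshift : ∀ s ∈ rightHalfPlane, -ε < (s - (ε : ℂ)).re := by
    intro s hs
    simpa [rightHalfPlane] using hs
  refine ⟨⟨ε, hε, fun i j s hs => ?_, fun s hs => ?_⟩, _, hDL, hlim⟩
  · exact (RatFunc.analyticAt_eval ((hV _ (hshift s hs)).1 i j)).comp_of_eq
      (analyticAt_id.sub analyticAt_const) rfl
  · exact PosDef.posSemidef (hV _ (hshift s hs)).2

/-! ### Strictly positive real functions with a positive definite limit -/

/-- Strict positivity of the real part of an analytic function. -/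
theorem re_pos_of_re_nonneg {g : ℂ → ℂ} {U : Set ℂ} (hU : IsOpen U) (hc : IsPreconnected U)
    (hg : DifferentiableOn ℂ g U) (h0 : ∀ s ∈ U, 0 ≤ (g s).re) {z : ℂ} (hz : z ∈ U)
    (hpos : 0 < (g z).re) {s : ℂ} (hs : s ∈ U) : 0 < (g s).re := by
  by_contra! hcon
  have hnorm : ∀ w, ‖Complex.exp (-g w)‖ = Real.exp (-(g w).re) := fun w => by
    rw [Complex.norm_exp, Complex.neg_re]
  -- A zero of `Re g` would maximise `‖exp (-g)‖`, forcing this norm to be constant, against `hpos`.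
  have hmax : IsMaxOn (norm ∘ fun w => Complex.exp (-g w)) U s := by
    intro w hw
    simp only [Function.comp_apply, Set.mem_ofPred_eq, hnorm, Real.exp_le_exp]
    linarith [h0 w hw]
  have := Complex.norm_eqOn_of_isPreconnected_of_isMaxOn hc hU hg.neg.cexp hs hmax hz
  simp only [Function.comp_apply, Function.const_apply, Pi.neg_apply, hnorm, Real.exp_eq_exp] at this
  linarith

/-- For fixed `v ≠ 0`, `star v ⬝ᵥ (G s *ᵥ v)` is analytic with nonnegative real part, positive at a
large real point because `D` is definite. -/
theorem mem_lyapunovSet_of_tendsto {m : ℕ} {G : ℂ → Matrix (Fin m) (Fin m) ℂ} {ε : ℝ}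
    (han : ∀ i j (s : ℂ), -ε < s.re → AnalyticAt ℂ (fun s => G s i j) s)
    (hpos : ∀ s : ℂ, -ε < s.re → G s ∈ closedLyapunovSet m)
    {D : Matrix (Fin m) (Fin m) ℂ} (hD : D ∈ lyapunovSet m)
    (hlim : Tendsto G (Bornology.cobounded ℂ) (𝓝 D)) {s : ℂ} (hs : -ε < s.re) :
    G s ∈ lyapunovSet m := by
  have hadd : Continuous fun A : Matrix (Fin m) (Fin m) ℂ => A + Aᴴ := by fun_prop
  obtain ⟨t, htD, ht⟩ : ∃ t : ℝ, G t ∈ lyapunovSet m ∧ -ε < t := by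
    have h1 := eventually_posDef
      ((hadd.tendsto _).comp (hlim.comp tendsto_ofReal_cobounded)) hD
      fun _ => isHermitian_add_conjTranspose _
    exact (h1.and (eventually_gt_atTop (-ε))).exists
  refine (isHermitian_add_conjTranspose _).posDef_iff_re.2 fun v hv => ?_
  have hg : DifferentiableOn ℂ (fun s => star v ⬝ᵥ (G s *ᵥ v)) {s : ℂ | -ε < s.re} := by
    intro s hs
    refine DifferentiableAt.differentiableWithinAt ?_
    simp only [dotProduct, mulVec]
    exact DifferentiableAt.fun_sum fun i _ => (DifferentiableAt.fun_sum fun j _ =>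
      ((han i j s hs).differentiableAt.mul_const _)).const_mul _
  have h2 := re_pos_of_re_nonneg (isOpen_lt continuous_const Complex.continuous_re)
    (convex_halfSpace_re_gt (-ε)).isPreconnected hg
    (fun w hw => by
      have := (isHermitian_add_conjTranspose _).posSemidef_iff_re.1 (hpos w hw) v
      rw [re_dotProduct_add_conjTranspose] at this
      linarith)
    (z := (t : ℂ)) (by simpa using ht)
    (by
      have := (isHermitian_add_conjTranspose _).posDef_iff_re.1 htD v hv
      rw [re_dotProduct_add_conjTranspose] at this
      linarith) hs
  rw [re_dotProduct_add_conjTranspose]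
  linarith

theorem IsStrictlyPositiveReal.hyperPositiveReal {m : ℕ} {G : ℂ → Matrix (Fin m) (Fin m) ℂ}
    (hG : IsStrictlyPositiveReal G) {D : Matrix (Fin m) (Fin m) ℂ} (hD : D ∈ lyapunovSet m)
    (hlim : Tendsto G (Bornology.cobounded ℂ) (𝓝 D)) : IsHyperPositiveReal G := by
  obtain ⟨ε, hε, han', hpos'⟩ := hG
  have han : ∀ i j (s : ℂ), -ε < s.re → AnalyticAt ℂ (fun s => G s i j) s := by
    intro i j s hs
    have h1 := han' i j (s + ε) (by
      simp only [rightHalfPlane, Set.mem_ofPred_eq, Complex.add_re, Complex.ofReal_re]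
      linarith)
    have h2 := h1.comp (f := fun w : ℂ => w + ε) (analyticAt_id.add analyticAt_const)
    simpa [Function.comp_def] using h2
  have hpos : ∀ s : ℂ, -ε < s.re → G s ∈ closedLyapunovSet m := by
    intro s hs
    simpa using hpos' (s + ε) (by
      simp only [rightHalfPlane, Set.mem_ofPred_eq, Complex.add_re, Complex.ofReal_re]
      linarith)
  -- Perturbs `c = 0` and `s` jointly; the filter `l` covers both finite points and ∞.
  have hev : ∀ {l : Filter ℂ} {A : Matrix (Fin m) (Fin m) ℂ}, A ∈ lyapunovSet m →
      Tendsto G l (𝓝 A) → ∀ᶠ z : ℝ × ℂ in 𝓝 0 ×ˢ l, (hyperForm z.1 (G z.2)).PosDef := by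
    intro l A hA hl
    refine eventually_posDef (A := hyperForm 0 A) ?_ (by simpa [hyperForm, lyapunovSet] using hA)
      fun z => isHermitian_hyperForm z.1 (G z.2)
    exact ((continuous_hyperForm m).tendsto (0, A)).comp
      (nhds_prod_eq (x := (0 : ℝ)) (y := A) ▸ tendsto_fst.prodMk (hl.comp tendsto_snd))
  obtain ⟨S, hS, T, hT, hST⟩ := eventually_prod_iff.1 (hev hD hlim)
  obtain ⟨R, hR⟩ : ∃ R, ∀ s : ℂ, R < ‖s‖ → T s := by
    obtain ⟨R, -, hR⟩ := (hasBasis_cobounded_norm (E := ℂ)).eventually_iff.1 hT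
    exact ⟨R, fun s hs => hR hs.le⟩
  have hK : IsCompact ({s : ℂ | 0 ≤ s.re} ∩ Metric.closedBall 0 R) :=
    (isCompact_closedBall _ _).inter_left (isClosed_le continuous_const Complex.continuous_re)
  have hunif := hK.eventually_forall_of_forall_eventually (x₀ := (0 : ℝ))
    (P := fun c s => (hyperForm c (G s)).PosDef) fun s hs => by
      have hs' : -ε < s.re := by have : 0 ≤ s.re := hs.1; linarith
      rw [nhds_prod_eq]
      exact hev (mem_lyapunovSet_of_tendsto han hpos hD hlim hs')
        (continuousAt_matrix fun i j => han i j s hs')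
  have hright : ∀ᶠ c : ℝ in 𝓝[>] 0, c < 1 ∧ 0 < c ∧ S c ∧
      ∀ s ∈ {s : ℂ | 0 ≤ s.re} ∩ Metric.closedBall 0 R, (hyperForm c (G s)).PosDef := by
    filter_upwards [nhdsWithin_le_nhds (Iio_mem_nhds one_pos), self_mem_nhdsWithin,
      nhdsWithin_le_nhds hS, nhdsWithin_le_nhds hunif] with c h1 h2 h3 h4
    exact ⟨h1, h2, h3, h4⟩
  obtain ⟨c, hc1, hc0, hcS, hcK⟩ := hright.exists
  refine ⟨1 / c, (one_lt_div hc0).2 hc1, fun i j s hs => ?_, fun s hs => ?_⟩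
  · have : 0 < s.re := hs
    exact han i j s (by linarith)
  · rw [one_div_one_div]
    change (hyperForm c (G s)).PosSemidef
    rcases le_or_gt ‖s‖ R with h | h
    · exact (hcK s ⟨(show 0 < s.re from hs).le, by simpa using h⟩).posSemidef
    · exact (hST hcS (hR s h)).posSemidef

theorem mainTheorem11 (m : ℕ) (F : Matrix (Fin m) (Fin m) (RatFunc ℂ)) :
    IsHyperPositiveReal (evalAt F) ↔
      (IsStrictlyPositiveReal (evalAt F) ∧
        ∃ D ∈ lyapunovSet m, Tendsto (evalAt F) (Bornology.cobounded ℂ) (𝓝 D)) :=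
  ⟨fun h => h.strictlyPositiveReal_and_tendsto,
    fun ⟨h, _, hD, hlim⟩ => h.hyperPositiveReal hD hlim⟩
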